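/- **Theorem 4.6 (Schur complement theorem for the quantum Berezinian).** Let $K$ be a field, $q\in K^\times$, $A$ an associative unital $K$-algebra, and $m,n\ge 0$. For $i\in\{1,\dots,m+n\}$ put $\bar i=0$ if $i\le m$ and $\bar i=1$ if $i>m$, and let $\varepsilon(a)\in\{1,0,-1\}$ be the sign of the integer $a$. An $(m+n)\times(m+n)$ matrix $M=(M_{ij})$ over $A$ is called $q$-super Manin if for all indices $i,j,k,l$ $$M_{ij}^2=0\ \ (\bar i=1,\ \bar j=0),\qquad M_{ik}M_{il}=q^{\varepsilon(l-k)}(-1)^{(\bar k+1)(\bar l+1)}M_{il}M_{ik}\ \ (\bar i=1),$$ $$M_{ik}M_{jk}=q^{\varepsilon(i-j)}(-1)^{\bar i\bar j}M_{jk}M_{ik}\ \ (\bar k=0),$$ $$M_{ij}M_{kl}-q^{\varepsilon(i-k)+\varepsilon(l-j)}(-1)^{(\bar i+\bar j)(\bar k+\bar l)}M_{kl}M_{ij}=q^{\varepsilon(i-k)}(-1)^{\bar i\bar k+\bar j\bar k+\bar i\bar j}M_{kj}M_{il}-q^{\varepsilon(l-j)}(-1)^{\bar j\bar k+\bar j\bar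 l+\bar k\bar l}M_{il}M_{kj}.$$ For an invertible square matrix $B$ over $A$ with $r$ even indices followed by $s$ odd indices, the quantum Berezinian is $$\mathrm{Ber}_q(B)=\sum_{\sigma\in\mathfrak S_r}(-q)^{-l(\sigma)}B_{\sigma(1),1}\cdots B_{\sigma(r),r}\ \cdot\ \sum_{\rho\in\mathfrak S_s}(-q)^{-l(\rho)}(B^{-1})_{r+1,r+\rho(1)}\cdots (B^{-1})_{r+s,r+\rho(s)},$$ where $l$ is the number of inversions. Let $M$ be a $q$-super Manin matrix which has a two-sided inverse $M^{-1}$ over $A$ that is $q^{-1}$-super Manin (these are among the defining relations of the Hopf envelope of the right quantum superalgebra, so they hold for its generator matrix). Let $0\le k\le m+n$ and write $$M=\begin{pmatrix}M_{11}&M_{12}\\ M_{21}&M_{22}\end{pmatrix}$$ with $M_{11}$ of size $k\times k$ and $M_{22}$ of size $(m+n-k)\times(m+n-k)$. Suppose that $M_{11}$ is invertible. Then $M_{22}-M_{21}M_{11}^{-1}M_{12}$ is invertible and $$\mathrm{Ber}_q(M)=\mathrm{Ber}_q(M_{11})\,\mathrm{Ber}_q\!\left(M_{22}-M_{21}M_{11}^{-1}M_{12}\right),$$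 where rows and columns of $M_{11}$ and of the Schur complement keep the parities they have in $M$; that is, $M_{11}$ has $\min(k,m)$ even indices and the Schur complement has $\max(m-k,0)$ even indices. -/

import Mathlib

namespace QSuper

/-- The parity of the `i`-th index when the first `m` indices are even and all later ones odd. -/
def parity (m : ℕ) {N : ℕ} (i : Fin N) : ℕ := if (i : ℕ) < m then 0 else 1

/-- The symbol `ε(i - j)`, equal to `1`, `0`, `-1` for `i > j`, `i = j`, `i < j`. -/
def eps {N : ℕ} (i j : Fin N) : ℤ := Int.sign ((i : ℤ) - (j : ℤ))

/-- The defining relations of the right quantum superalgebra, imposed on the entries of a square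
matrix `M` whose first `m` indices are even and whose remaining indices are odd. -/
structure IsQSuperManin {K A : Type*} [Field K] [Ring A] [Algebra K A]
    (q : K) (m : ℕ) {N : ℕ} (M : Matrix (Fin N) (Fin N) A) : Prop where
  sq : ∀ i j, parity m i = 1 → parity m j = 0 → M i j ^ 2 = 0
  row : ∀ i k l, parity m i = 1 →
    M i k * M i l
      - (q ^ eps l k * (-1 : K) ^ ((parity m k + 1) * (parity m l + 1))) • (M i l * M i k) = 0
  col : ∀ i j k, parity m k = 0 →
    M i k * M j k
      - (q ^ eps i j * (-1 : K) ^ (parity m i * parity m j)) • (M j k * M i k) = 0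
  cross : ∀ i j k l,
    M i j * M k l
      - (q ^ (eps i k + eps l j) *
          (-1 : K) ^ ((parity m i + parity m j) * (parity m k + parity m l))) • (M k l * M i j)
    = (q ^ eps i k *
          (-1 : K) ^ (parity m i * parity m k + parity m j * parity m k
            + parity m i * parity m j)) • (M k j * M i l)
      - (q ^ eps l j *
          (-1 : K) ^ (parity m j * parity m k + parity m j * parity m l
            + parity m k * parity m l)) • (M i l * M k j)

/-- The length (number of inversions) of a permutation. -/
def invCount {r : ℕ} (σ : Equiv.Perm (Fin r)) : ℕ :=
  (Finset.univ.filter fun p : Fin r × Fin r => p.1 < p.2 ∧ σ p.2 < σ p.1).card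

/-- `∑_σ (-q)^{-l(σ)} B_{σ(1),1} B_{σ(2),2} ⋯ B_{σ(r),r}`. -/
noncomputable def colDet {K A : Type*} [Field K] [Ring A] [Algebra K A]
    (q : K) {r : ℕ} (B : Matrix (Fin r) (Fin r) A) : A :=
  ∑ σ : Equiv.Perm (Fin r),
    ((-q) ^ (-(invCount σ : ℤ))) • (List.ofFn fun i => B (σ i) i).prod

/-- `∑_ρ (-q)^{-l(ρ)} B_{1,ρ(1)} B_{2,ρ(2)} ⋯ B_{r,ρ(r)}`. -/
noncomputable def rowDet {K A : Type*} [Field K] [Ring A] [Algebra K A]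
    (q : K) {r : ℕ} (B : Matrix (Fin r) (Fin r) A) : A :=
  ∑ ρ : Equiv.Perm (Fin r),
    ((-q) ^ (-(invCount ρ : ℤ))) • (List.ofFn fun i => B i (ρ i)).prod

/-- The inclusion of the even indices (those below `m`) into `Fin N`, in increasing order. -/
def evenIdx (m N : ℕ) : Fin (min m N) → Fin N := Fin.castLE (min_le_right m N)

/-- The inclusion of the indices `m, m + 1, …, N - 1` into `Fin N`, in increasing order. -/
def tailIdx (m N : ℕ) : Fin (N - m) → Fin N := fun j => ⟨m + (j : ℕ), by omega⟩

/-- The quantum Berezinian of a square matrix `M` whose first `m` indices are even and whose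
remaining indices are odd: the column `q`-determinant of the even-even block of `M` times the row
`q`-determinant of the odd-odd block of `M⁻¹`. Here `Ring.inverse M` is the two-sided inverse in
the ring of matrices over the noncommutative ring `A`, whenever `M` is invertible. -/
noncomputable def ber {K A : Type*} [Field K] [Ring A] [Algebra K A]
    (q : K) (m : ℕ) {N : ℕ} (M : Matrix (Fin N) (Fin N) A) : A :=
  colDet q (M.submatrix (evenIdx m N) (evenIdx m N)) *
    rowDet q ((Ring.inverse M).submatrix (tailIdx m N) (tailIdx m N))

section Blocks

variable {A : Type*} {N k : ℕ}

/-- The upper left `k × k` block. -/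
def block11 (hk : k ≤ N) (M : Matrix (Fin N) (Fin N) A) : Matrix (Fin k) (Fin k) A :=
  M.submatrix (Fin.castLE hk) (Fin.castLE hk)

/-- The upper right block, with `k` rows. -/
def block12 (hk : k ≤ N) (M : Matrix (Fin N) (Fin N) A) : Matrix (Fin k) (Fin (N - k)) A :=
  M.submatrix (Fin.castLE hk) (tailIdx k N)

/-- The lower left block, with `k` columns. -/
def block21 (hk : k ≤ N) (M : Matrix (Fin N) (Fin N) A) : Matrix (Fin (N - k)) (Fin k) A :=
  M.submatrix (tailIdx k N) (Fin.castLE hk)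

/-- The lower right block, of size `N - k`. -/
def block22 (k : ℕ) (M : Matrix (Fin N) (Fin N) A) :
    Matrix (Fin (N - k)) (Fin (N - k)) A :=
  M.submatrix (tailIdx k N) (tailIdx k N)

/-- The Schur complement `M₂₂ - M₂₁ M₁₁⁻¹ M₁₂` (meaningful when `M₁₁` is invertible). -/
noncomputable def schur [Ring A] (hk : k ≤ N) (M : Matrix (Fin N) (Fin N) A) :
    Matrix (Fin (N - k)) (Fin (N - k)) A :=
  block22 k M - block21 hk M * Ring.inverse (block11 hk M) * block12 hk M

end Blocks

end QSuper

/-!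
The Berezinian of `M` only sees the even-even block of `M` and the odd-odd block of `Y = M⁻¹`, and
both are, up to exchanging rows and columns for the latter, purely even quantum Manin matrices. So
the theorem splits into two Schur complement formulas for ordinary quantum determinants.

For the column determinant of a `q`-Manin matrix `B` (`colDet_eq_mul`), let `φ j = ∑ i, ψ i * B i j`
in the `q`-Grassmann algebra with generators `ψ i`. The Manin relations say that the `φ j`
`q`-anticommute and have square zero, and `φ 1 ⋯ φ t = colDet B • ψ 1 ⋯ ψ t`. Hence
`φ 1 ⋯ φ k` is killed by each of `φ 1, …, φ k`, also after multiplying by further `φ j`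
(`wedge_wedgeList_of_mem`), and right combinations of them may be subtracted from the later factors
(`wedgeList_map_sub`). Subtracting the columns of `B₁₁⁻¹ B₁₂` leaves factors involving only
the `ψ i` with `i > k`, with coefficients in the Schur complement, so the product of all factors has
the coefficient `colDet B₁₁ * colDet (B₂₂ - B₂₁ B₁₁⁻¹ B₁₂)` (`wedgeList_union`). Neither
invertibility nor Manin relations of the Schur complement enter. Reflecting in the antidiagonal over
the opposite ring gives the row version (`rowDet_eq_mul`).

If `k ≤ m`, the odd-odd block of `Y` is also that of `S⁻¹ = Y₂₂`, where `S` is the Schur complement,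
and the column formula applies to the even-even block of `M`. If `m ≤ k`, the even-even blocks of
`M` and `M₁₁` coincide, and the row formula applies to the odd-odd block of `Y`, because
`M₁₁⁻¹ = Y₁₁ - Y₁₂ Y₂₂⁻¹ Y₂₁` (`schur_inverse`).
-/

namespace QSuper

/-! ### The `q`-Grassmann algebra -/

section Grassmann

variable {K A ι : Type*} [Field K] [Ring A] [Algebra K A] [LinearOrder ι]

/-- Right multiplication by the vector `∑ i, ψ i * v i` on the `q`-Grassmann algebra over `A`, with
generators `ψ i` subject to `ψ j * ψ i = (-q)⁻¹ • (ψ i * ψ j)` for `i < j` and `ψ i ^ 2 = 0`, and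
commuting with `A`. An element is encoded by its coefficients `f S` at the ordered monomials
`∏ i ∈ S, ψ i`; moving `ψ i` into its place in such a monomial passes the `j ∈ S` with `i < j`. -/
noncomputable def wedge (q : K) (f : Finset ι → A) (v : ι → A) : Finset ι → A := fun S =>
  ∑ i ∈ S, ((-q)⁻¹ ^ (S.filter fun j => i < j).card) • (f (S.erase i) * v i)

/-- The unit of the `q`-Grassmann algebra. -/
def wedgeOne : Finset ι → A := fun S => if S = ∅ then 1 else 0

/-- The product `f * v₁ * ⋯ * vᵣ` in the `q`-Grassmann algebra, for a list `v₁, …, vᵣ` of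
vectors. -/
noncomputable def wedgeList (q : K) (f : Finset ι → A) (L : List (ι → A)) : Finset ι → A :=
  L.foldl (wedge q) f

/-- The coefficient of `ψ i * ψ j` in the product of the vectors `v` and `w`, for `i < j`. -/
def minor (q : K) (v w : ι → A) (i j : ι) : A := v i * w j - q⁻¹ • (v j * w i)

lemma sum_sum_erase (S : Finset ι) (F : ι → ι → A) :
    ∑ i ∈ S, ∑ j ∈ S.erase i, F i j = ∑ i ∈ S, ∑ j ∈ S with j < i, (F i j + F j i) := by
  have h1 : ∀ i ∈ S, ∑ j ∈ S.erase i, F i j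
      = ∑ j ∈ S with j < i, F i j + ∑ j ∈ S with i < j, F i j := by
    intro i _
    rw [← Finset.sum_union]
    · congr 1
      ext j
      simp only [Finset.mem_erase, Finset.mem_union, Finset.mem_filter]
      constructor
      · rintro ⟨h, hj⟩
        rcases lt_or_gt_of_ne h with h | h
        · exact Or.inl ⟨hj, h⟩
        · exact Or.inr ⟨hj, h⟩
      · rintro (⟨hj, h⟩ | ⟨hj, h⟩)
        · exact ⟨h.ne, hj⟩
        · exact ⟨h.ne', hj⟩
    · rw [Finset.disjoint_left]
      intro j hj hj'
      exact lt_asymm (Finset.mem_filter.1 hj).2 (Finset.mem_filter.1 hj').2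
  rw [Finset.sum_congr rfl h1, Finset.sum_add_distrib]
  simp_rw [Finset.sum_add_distrib]
  congr 1
  refine Finset.sum_comm' fun i j => ?_
  simp only [Finset.mem_filter]
  tauto

/-- Multiplying by two vectors in a row only involves the `2 × 2` quantum minors. -/
lemma wedge_wedge (q : K) (f : Finset ι → A) (v w : ι → A) (S : Finset ι) :
    wedge q (wedge q f v) w S = ∑ i ∈ S, ∑ j ∈ S with j < i,
      ((-q)⁻¹ ^ (S.filter fun x => i < x).card *
        (-q)⁻¹ ^ ((S.erase i).filter fun x => j < x).card) •
        (f ((S.erase i).erase j) * minor q v w j i) := by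
  have : wedge q (wedge q f v) w S = ∑ i ∈ S, ∑ j ∈ S.erase i,
      ((-q)⁻¹ ^ (S.filter fun x => i < x).card *
        (-q)⁻¹ ^ ((S.erase i).filter fun x => j < x).card) •
        (f ((S.erase i).erase j) * (v j * w i)) := by
    simp only [wedge, Finset.sum_mul, Finset.smul_sum, smul_mul_assoc, smul_smul, mul_assoc]
  rw [this, sum_sum_erase]
  refine Finset.sum_congr rfl fun i hi => Finset.sum_congr rfl fun j hj => ?_
  obtain ⟨hj, hji⟩ := Finset.mem_filter.1 hj
  have e1 : ((S.erase j).filter fun x => i < x) = S.filter fun x => i < x := by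
    ext x
    simp only [Finset.mem_filter, Finset.mem_erase]
    exact ⟨fun h => ⟨h.1.2, h.2⟩, fun h => ⟨⟨(hji.trans h.2).ne', h.1⟩, h.2⟩⟩
  have e2 : (S.filter fun x => j < x).card = ((S.erase i).filter fun x => j < x).card + 1 := by
    rw [Finset.filter_erase, Finset.card_erase_add_one (Finset.mem_filter.2 ⟨hi, hji⟩)]
  -- In the order `i, j` the factor `ψ j` passes `ψ i`, which costs the extra factor `(-q)⁻¹`.
  rw [e1, e2, Finset.erase_right_comm (a := j) (b := i), minor, mul_sub, mul_smul_comm, smul_sub,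
    smul_smul, sub_eq_add_neg, ← neg_smul]
  congr 2
  rw [pow_succ, inv_neg]
  ring

/-- The quantum minors of `(v, w)` are a common scalar multiple of those of `(w, v)`; hence so are
the products of the two vectors in the `q`-Grassmann algebra. -/
def QAnticomm (q : K) (v w : ι → A) : Prop :=
  ∃ c : K, ∀ i j, i < j → minor q v w i j = c • minor q w v i j

lemma QAnticomm.wedge_wedge {q : K} {v w : ι → A} (h : QAnticomm q v w) :
    ∃ c : K, ∀ f : Finset ι → A, wedge q (wedge q f v) w = c • wedge q (wedge q f w) v := by
  obtain ⟨c, hc⟩ := h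
  refine ⟨c, fun f => funext fun S => ?_⟩
  rw [Pi.smul_apply, QSuper.wedge_wedge, QSuper.wedge_wedge, Finset.smul_sum]
  refine Finset.sum_congr rfl fun i _ => ?_
  rw [Finset.smul_sum]
  refine Finset.sum_congr rfl fun j hj => ?_
  rw [hc j i (Finset.mem_filter.1 hj).2, mul_smul_comm, smul_comm]

lemma wedge_self {q : K} {v : ι → A} (h : ∀ i j, i < j → minor q v v i j = 0)
    (f : Finset ι → A) : wedge q (wedge q f v) v = 0 := by
  funext S
  rw [wedge_wedge]
  refine Finset.sum_eq_zero fun i _ => Finset.sum_eq_zero fun j hj => ?_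
  rw [h j i (Finset.mem_filter.1 hj).2, mul_zero, smul_zero]

lemma wedge_zero_left (q : K) (v : ι → A) : wedge q (0 : Finset ι → A) v = 0 := by
  funext S
  simp [wedge]

lemma wedge_sub_sum (q : K) (f : Finset ι → A) (v : ι → A) {κ : Type*} [Fintype κ]
    (w : κ → ι → A) (x : κ → A) (h : ∀ a, wedge q f (w a) = 0) :
    wedge q f (fun i => v i - ∑ a, w a i * x a) = wedge q f v := by
  funext S
  have h0 : ∑ i ∈ S, ((-q)⁻¹ ^ (S.filter fun j => i < j).card) •
      (f (S.erase i) * ∑ a, w a i * x a) = ∑ a, wedge q f (w a) S * x a := by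
    simp only [wedge, Finset.sum_mul, Finset.mul_sum, Finset.smul_sum, smul_mul_assoc, mul_assoc]
    exact Finset.sum_comm
  simp only [wedge, mul_sub, smul_sub, Finset.sum_sub_distrib]
  rw [h0]
  simp [h]

/-- A product of `q`-anticommuting vectors of square zero is killed by each of its factors. -/
lemma wedge_wedgeList_of_mem {q : K} (f : Finset ι → A) (L : List (ι → A)) (v : ι → A)
    (hv : ∀ i j, i < j → minor q v v i j = 0) (hL : ∀ w ∈ L, QAnticomm q w v) (hmem : v ∈ L) :
    wedge q (wedgeList q f L) v = 0 := by
  induction L using List.reverseRecOn with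
  | nil => simp at hmem
  | append_singleton L w ih =>
    simp only [wedgeList, List.foldl_append, List.foldl_cons, List.foldl_nil]
    rcases eq_or_ne v w with rfl | hne
    · exact wedge_self hv _
    · obtain ⟨c, hc⟩ := (hL w (by simp)).wedge_wedge
      have := ih (fun u hu => hL u (by simp [hu])) (by simpa [hne] using hmem)
      rw [wedgeList] at this
      rw [hc, this, wedge_zero_left, smul_zero]

/-- Column elimination: if `f` is killed by each `w a`, then the product of `f` with further vectors
is unchanged when right combinations of the `w a` are subtracted from these vectors. -/
lemma wedgeList_map_sub {q : K} {κ : Type*} [Fintype κ] (w : κ → ι → A)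
    (L : List ((ι → A) × (κ → A))) (f : Finset ι → A) (hf : ∀ a, wedge q f (w a) = 0)
    (hL : ∀ v ∈ L, ∀ a, QAnticomm q v.1 (w a)) :
    wedgeList q f (L.map fun v i => v.1 i - ∑ a, w a i * v.2 a)
      = wedgeList q f (L.map Prod.fst) := by
  induction L generalizing f with
  | nil => rfl
  | cons v L ih =>
    simp only [wedgeList, List.map_cons, List.foldl_cons] at ih ⊢
    rw [wedge_sub_sum q f v.1 w v.2 hf]
    refine ih _ (fun a => ?_) fun u hu => hL u (by simp [hu])
    obtain ⟨c, hc⟩ := (hL v (by simp) a).wedge_wedge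
    rw [hc, hf, wedge_zero_left, smul_zero]

/-- If all factors of a product are supported above `T`, then its coefficients at `T ∪ U` split. -/
lemma wedgeList_union {q : K} (f : Finset ι → A) (T : Finset ι) (L : List (ι → A))
    (hL : ∀ v ∈ L, ∀ i ∈ T, v i = 0) (U : Finset ι) (hU : U.card = L.length)
    (hTU : ∀ i ∈ T, ∀ j ∈ U, i < j) :
    wedgeList q f L (T ∪ U) = f T * wedgeList q wedgeOne L U := by
  induction L using List.reverseRecOn generalizing U with
  | nil =>
    obtain rfl : U = ∅ := by simpa using hU
    simp [wedgeList, wedgeOne]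
  | append_singleton L w ih =>
    have hdisj : Disjoint T U := Finset.disjoint_left.2 fun i hi hi' => lt_irrefl _ (hTU i hi i hi')
    simp only [wedgeList, List.foldl_append, List.foldl_cons, List.foldl_nil] at ih ⊢
    rw [wedge, wedge, Finset.sum_union hdisj, Finset.sum_eq_zero, zero_add, Finset.mul_sum]
    · refine Finset.sum_congr rfl fun i hi => ?_
      have hiT : i ∉ T := fun h => lt_irrefl _ (hTU i h i hi)
      have e1 : ((T ∪ U).filter fun j => i < j) = U.filter fun j => i < j := by
        rw [Finset.filter_union, Finset.filter_eq_empty_iff.2, Finset.empty_union]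
        exact fun j hj => (hTU j hj i hi).asymm
      rw [e1, Finset.erase_union_distrib, Finset.erase_eq_of_notMem hiT,
        ih (fun v hv => hL v (by simp [hv])) (U.erase i)
          (by rw [Finset.card_erase_of_mem hi, hU]; simp)
          (fun a ha b hb => hTU a ha b (Finset.mem_of_mem_erase hb)),
        mul_smul_comm, mul_assoc]
    · intro i hi
      rw [hL w (by simp) i hi, mul_zero, smul_zero]

end Grassmann

/-! ### Coefficients as sums over permutations -/

section Expansion

variable {K A ι : Type*} [Field K] [Ring A] [Algebra K A] [LinearOrder ι]

/-- The number of inversions of a word. -/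
def wordInv {r : ℕ} (g : Fin r → ι) : ℕ :=
  (Finset.univ.filter fun p : Fin r × Fin r => p.1 < p.2 ∧ g p.2 < g p.1).card

lemma wordInv_snoc {r : ℕ} (g : Fin r → ι) (hg : Function.Injective g) (i : ι) :
    wordInv (Fin.snoc g i : Fin (r + 1) → ι)
      = wordInv g + ((Finset.univ.image g).filter fun j => i < j).card := by
  rw [Finset.filter_image, Finset.card_image_of_injective _ hg]
  simp only [wordInv, Finset.card_filter, Fintype.sum_prod_type, Fin.sum_univ_castSucc,
    Fin.snoc_castSucc, Fin.snoc_last, Fin.castSucc_lt_castSucc_iff, Fin.castSucc_lt_last, true_and,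
    (Fin.castSucc_lt_last _).not_gt, lt_irrefl, false_and, if_false, Finset.sum_const_zero,
    add_zero, Finset.sum_add_distrib]

lemma snoc_injective_image_iff {r : ℕ} (g : Fin r → ι) (i : ι) (S : Finset ι) :
    (Function.Injective (Fin.snoc g i : Fin (r + 1) → ι) ∧
        Finset.univ.image (Fin.snoc g i : Fin (r + 1) → ι) = S)
      ↔ i ∈ S ∧ Function.Injective g ∧ Finset.univ.image g = S.erase i := by
  have himg : Finset.univ.image (Fin.snoc g i : Fin (r + 1) → ι)
      = insert i (Finset.univ.image g) := by
    ext x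
    simp [Fin.exists_fin_succ', or_comm, eq_comm]
  rw [himg, Fin.snoc_injective_iff]
  constructor
  · rintro ⟨⟨h1, h2⟩, rfl⟩
    have h2' : i ∉ Finset.univ.image g := by simpa using h2
    exact ⟨by simp, h1, by rw [Finset.erase_insert h2']⟩
  · rintro ⟨h1, h2, h3⟩
    have h2' : i ∉ Finset.univ.image g := by rw [h3]; simp
    exact ⟨⟨h2, by simpa using h2'⟩, by rw [h3, Finset.insert_erase h1]⟩

open Classical in
/-- The coefficients of a product of vectors in the `q`-Grassmann algebra, as sums over words. -/
lemma wedgeList_ofFn [Fintype ι] (q : K) {r : ℕ} (v : Fin r → ι → A) (S : Finset ι) :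
    wedgeList q wedgeOne (List.ofFn v) S
      = ∑ g : Fin r → ι, if Function.Injective g ∧ Finset.univ.image g = S then
          ((-q)⁻¹ ^ wordInv g) • (List.ofFn fun a => v a (g a)).prod else 0 := by
  induction r generalizing S with
  | zero =>
    simp [wedgeList, wedgeOne, wordInv, Function.injective_of_subsingleton, eq_comm]
  | succ r ih =>
    have h1 : wedgeList q wedgeOne (List.ofFn v) = wedge q (wedgeList q wedgeOne
        (List.ofFn fun a : Fin r => v a.castSucc)) (v (Fin.last r)) := by
      rw [wedgeList, List.ofFn_succ', List.concat_eq_append, List.foldl_append]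
      rfl
    rw [h1, wedge, ← (Fin.snocEquiv fun _ : Fin (r + 1) => ι).sum_comp, Fintype.sum_prod_type,
      ← Finset.sum_subset (Finset.subset_univ S)]
    · refine Finset.sum_congr rfl fun i hi => ?_
      rw [ih, Finset.sum_mul, Finset.smul_sum]
      refine Finset.sum_congr rfl fun g _ => ?_
      change _ = if Function.Injective (Fin.snoc g i : Fin (r + 1) → ι) ∧
          Finset.univ.image (Fin.snoc g i : Fin (r + 1) → ι) = S then
        ((-q)⁻¹ ^ wordInv (Fin.snoc g i : Fin (r + 1) → ι)) • (List.ofFn fun a =>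
          v a ((Fin.snoc g i : Fin (r + 1) → ι) a)).prod else 0
      simp only [snoc_injective_image_iff, hi, true_and]
      split_ifs with h
      · have h2 : ((S.erase i).filter fun j => i < j) = S.filter fun j => i < j := by
          rw [Finset.filter_erase, Finset.erase_eq_of_notMem]
          simp
        rw [wordInv_snoc g h.1, h.2, h2, List.ofFn_succ', List.concat_eq_append,
          List.prod_append, smul_mul_assoc, smul_smul, pow_add, mul_comm]
        simp
      · simp
    · intro i _ hi
      refine Finset.sum_eq_zero fun g _ => ?_
      change (if Function.Injective (Fin.snoc g i : Fin (r + 1) → ι) ∧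
          Finset.univ.image (Fin.snoc g i : Fin (r + 1) → ι) = S then
        ((-q)⁻¹ ^ wordInv (Fin.snoc g i : Fin (r + 1) → ι)) • (List.ofFn fun a =>
          v a ((Fin.snoc g i : Fin (r + 1) → ι) a)).prod else 0) = 0
      rw [if_neg]
      rw [snoc_injective_image_iff]
      exact fun h => hi h.1

/-- Column `q`-determinants are coefficients of products in the `q`-Grassmann algebra. -/
lemma wedgeList_ofFn_image [Fintype ι] (q : K) {r : ℕ} (v : Fin r → ι → A) (e : Fin r → ι)
    (he : StrictMono e) :
    wedgeList q wedgeOne (List.ofFn v) (Finset.univ.image e)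
      = colDet q (Matrix.of fun i j => v j (e i)) := by
  classical
  rw [wedgeList_ofFn, colDet, ← Finset.sum_filter]
  symm
  refine Finset.sum_bij (fun σ _ => e ∘ σ) (fun σ _ => ?_) (fun σ _ τ _ h => ?_)
    (fun g hg => ?_) (fun σ _ => ?_)
  · simp only [Finset.mem_filter, Finset.mem_univ, true_and]
    refine ⟨he.injective.comp σ.injective, ?_⟩
    rw [← Finset.image_image, Finset.image_univ_of_surjective σ.surjective]
  · exact Equiv.ext fun a => he.injective (congrFun h a)
  · simp only [Finset.mem_filter, Finset.mem_univ, true_and] at hg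
    have hr : ∀ a, ∃ b, e b = g a := fun a => by
      have : g a ∈ Finset.univ.image e := hg.2 ▸ Finset.mem_image_of_mem g (Finset.mem_univ a)
      simpa using this
    choose s hs using hr
    have hinj : Function.Injective s := fun a b h => hg.1 (by rw [← hs, ← hs, h])
    exact ⟨Equiv.ofBijective s (Finite.injective_iff_bijective.1 hinj), Finset.mem_univ _,
      funext hs⟩
  · rw [zpow_neg, zpow_natCast, inv_pow]
    simp [wordInv, invCount, he.lt_iff_lt]

end Expansion

/-! ### Schur complement formulas for quantum determinants -/

section Determinants

open MulOpposite

variable {K A : Type*} [Field K] [Ring A] [Algebra K A]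

/-- A `q`-Manin matrix without odd indices: the entries of each column `q`-commute, and the quantum
minors on two columns agree up to a scalar when the columns are exchanged. -/
structure IsQManin (q : K) {κ ι : Type*} [LinearOrder ι] (B : Matrix ι κ A) : Prop where
  isotropic : ∀ a i j, i < j → minor q (B.col a) (B.col a) i j = 0
  anticomm : ∀ a b, QAnticomm q (B.col a) (B.col b)

/-- Schur complement formula for the column `q`-determinant. The index sets `{0, …, k - 1}` and
`{k, …, t - 1}` are given by arbitrary maps with these values, and the elimination matrix `X` plays
the role of `B₁₁⁻¹ B₁₂`. -/
theorem colDet_eq_mul {q : K} {k l t : ℕ} (hkl : k + l = t) {B : Matrix (Fin t) (Fin t) A}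
    (hB : IsQManin q B) (e₁ : Fin k → Fin t) (e₂ : Fin l → Fin t) (he₁ : ∀ i, (e₁ i : ℕ) = i)
    (he₂ : ∀ j, (e₂ j : ℕ) = k + j) (X : Matrix (Fin k) (Fin l) A)
    (hX : B.submatrix e₁ e₁ * X = B.submatrix e₁ e₂) :
    colDet q B = colDet q (B.submatrix e₁ e₁) *
      colDet q (B.submatrix e₂ e₂ - B.submatrix e₂ e₁ * X) := by
  subst hkl
  obtain rfl : e₁ = Fin.castAdd l := funext fun i => Fin.ext (he₁ i)
  obtain rfl : e₂ = Fin.natAdd k := funext fun i => Fin.ext (he₂ i)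
  set T : Finset (Fin (k + l)) := Finset.univ.image (Fin.castAdd l) with hT
  set U : Finset (Fin (k + l)) := Finset.univ.image (Fin.natAdd k) with hU
  set w : Fin k → Fin (k + l) → A := fun a => B.col (Fin.castAdd l a) with hw
  set v : Fin l → Fin (k + l) → A := fun j => B.col (Fin.natAdd k j) with hv
  have hTU : T ∪ U = Finset.univ.image id := by
    ext x
    simp only [hT, hU, Finset.mem_union, Finset.mem_image, Finset.mem_univ, true_and, id,
      exists_eq, iff_true]
    induction x using Fin.addCases with
    | left i => exact Or.inl ⟨i, rfl⟩
    | right i => exact Or.inr ⟨i, rfl⟩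
  have hkill : ∀ a, wedge q (wedgeList q wedgeOne (List.ofFn w)) (w a) = 0 := fun a =>
    wedge_wedgeList_of_mem _ _ _ (hB.isotropic _)
      (fun u hu => by
        obtain ⟨b, rfl⟩ := (List.mem_ofFn' _ _).1 hu
        exact hB.anticomm _ _)
      ((List.mem_ofFn' _ _).2 ⟨a, rfl⟩)
  have hcols : wedgeList q wedgeOne (List.ofFn B.col)
      = wedgeList q (wedgeList q wedgeOne (List.ofFn w))
        (List.ofFn fun j i => v j i - ∑ a, w a i * X a j) := by
    have h1 : B.col = Fin.append w v := by
      funext x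
      induction x using Fin.addCases <;> simp [hw, hv]
    have h2 := wedgeList_map_sub w (List.ofFn fun j => (v j, fun a => X a j)) _ hkill
      (fun u hu a => by
        obtain ⟨b, rfl⟩ := (List.mem_ofFn' _ _).1 hu
        exact hB.anticomm _ _)
    rw [List.map_ofFn, List.map_ofFn] at h2
    rw [h1, List.ofFn_fin_append, wedgeList, List.foldl_append]
    exact h2.symm
  have hB' : colDet q B = wedgeList q wedgeOne (List.ofFn B.col) (T ∪ U) := by
    rw [hTU, wedgeList_ofFn_image q B.col id strictMono_id]
    rfl
  rw [hB', hcols, wedgeList_union _ T _ _ U]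
  · rw [hT, hU, wedgeList_ofFn_image q _ _ (Fin.strictMono_castAdd l),
      wedgeList_ofFn_image q _ _ (Fin.strictMono_natAdd k)]
    rfl
  · rw [hU, Finset.card_image_of_injective _ (Fin.natAdd_injective l k)]
    simp
  · intro i hi j hj
    obtain ⟨i, -, rfl⟩ := Finset.mem_image.1 hi
    obtain ⟨j, -, rfl⟩ := Finset.mem_image.1 hj
    exact i.isLt.trans_le (Nat.le_add_right k j)
  · intro u hu i hi
    obtain ⟨j, rfl⟩ := (List.mem_ofFn' _ _).1 hu
    obtain ⟨i, -, rfl⟩ := Finset.mem_image.1 hi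
    have := congrFun (congrFun hX i) j
    rw [Matrix.mul_apply] at this
    exact sub_eq_zero.2 this.symm

/-- Transposing a matrix along the antidiagonal, over the opposite ring. -/
def flip {r s : ℕ} (W : Matrix (Fin r) (Fin s) A) : Matrix (Fin s) (Fin r) Aᵐᵒᵖ :=
  Matrix.of fun i j => op (W j.rev i.rev)

lemma invCount_rev_conj {r : ℕ} (σ : Equiv.Perm (Fin r)) :
    invCount (Fin.revPerm.permCongr σ) = invCount σ := by
  refine Finset.card_bij (fun p _ => (p.2.rev, p.1.rev)) ?_ ?_ ?_
  · rintro ⟨a, b⟩ h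
    simpa [Equiv.permCongr_apply] using h
  · rintro ⟨a, b⟩ _ ⟨c, d⟩ _ h
    simp only [Prod.mk.injEq, Fin.rev_inj] at h
    exact Prod.ext h.2 h.1
  · rintro ⟨a, b⟩ h
    refine ⟨(b.rev, a.rev), ?_, by simp⟩
    simpa [Equiv.permCongr_apply] using h

/-- A row `q`-determinant is a column `q`-determinant over the opposite ring. -/
lemma rowDet_eq_unop_colDet (q : K) {r : ℕ} (W : Matrix (Fin r) (Fin r) A) :
    rowDet q W = unop (colDet q (flip W)) := by
  rw [rowDet, colDet, ← (Fin.revPerm (n := r)).permCongr.sum_comp,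
    Finset.unop_sum]
  refine Finset.sum_congr rfl fun σ _ => ?_
  rw [unop_smul, invCount_rev_conj, unop_list_prod,
    List.map_ofFn]
  congr 2
  refine List.ext_getElem (by simp) fun i h _ => ?_
  rw [List.length_ofFn] at h
  have hi : (⟨r - 1 - i, by omega⟩ : Fin r) = Fin.rev ⟨i, h⟩ :=
    Fin.ext (by rw [Fin.val_rev]; simp only; omega)
  simp [flip, hi]

lemma flip_sub {r s : ℕ} (V W : Matrix (Fin r) (Fin s) A) : flip (V - W) = flip V - flip W := rfl

lemma flip_mul {r s t : ℕ} (V : Matrix (Fin r) (Fin s) A) (W : Matrix (Fin s) (Fin t) A) :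
    flip (V * W) = flip W * flip V := by
  ext i j
  simp only [flip, Matrix.of_apply, Matrix.mul_apply, ← op_mul, ← Finset.op_sum]
  exact congrArg op (Equiv.sum_comp (Fin.revPerm (n := s)) fun x => V j.rev x * W x i.rev).symm

/-- Schur complement formula for the row `q`-determinant, obtained from the one for the column
`q`-determinant by `flip`; the matrix `X` plays the role of `W₁₂ W₂₂⁻¹`. -/
theorem rowDet_eq_mul {q : K} {k l t : ℕ} (hkl : k + l = t) {W : Matrix (Fin t) (Fin t) A}
    (hW : IsQManin q (flip W)) (e₁ : Fin k → Fin t) (e₂ : Fin l → Fin t)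
    (he₁ : ∀ i, (e₁ i : ℕ) = i) (he₂ : ∀ j, (e₂ j : ℕ) = k + j) (X : Matrix (Fin k) (Fin l) A)
    (hX : X * W.submatrix e₂ e₂ = W.submatrix e₁ e₂) :
    rowDet q W = rowDet q (W.submatrix e₁ e₁ - X * W.submatrix e₂ e₁) *
      rowDet q (W.submatrix e₂ e₂) := by
  have hsub : ∀ {a b : ℕ} (f : Fin a → Fin t) (g : Fin b → Fin t),
      flip (W.submatrix f g) = (flip W).submatrix (fun i => (g i.rev).rev)
        (fun i => (f i.rev).rev) := by
    intro a b f g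
    ext i j
    simp [flip]
  have h := colDet_eq_mul (k := l) (l := k) (by omega) hW
    (fun i => (e₂ i.rev).rev) (fun i => (e₁ i.rev).rev)
    (fun i => by rw [Fin.val_rev, he₂, Fin.val_rev]; omega)
    (fun i => by rw [Fin.val_rev, he₁, Fin.val_rev]; omega) (flip X)
    (by rw [← hsub, ← hsub, ← hX, flip_mul])
  rw [rowDet_eq_unop_colDet, h, unop_mul, rowDet_eq_unop_colDet, rowDet_eq_unop_colDet, flip_sub,
    flip_mul, hsub, hsub, hsub]

lemma colDet_of_eq_zero (q : K) {r : ℕ} (hr : r = 0) (B : Matrix (Fin r) (Fin r) A) :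
    colDet q B = 1 := by
  subst hr
  simp [colDet, invCount]

lemma rowDet_of_eq_zero (q : K) {r : ℕ} (hr : r = 0) (B : Matrix (Fin r) (Fin r) A) :
    rowDet q B = 1 := by
  subst hr
  simp [rowDet, invCount]

lemma colDet_congr (q : K) {r s : ℕ} (h : r = s) (B : Matrix (Fin r) (Fin r) A)
    (C : Matrix (Fin s) (Fin s) A)
    (hBC : ∀ i j, B i j = C (Fin.cast h i) (Fin.cast h j)) : colDet q B = colDet q C := by
  subst h
  exact congrArg _ (Matrix.ext hBC)

lemma rowDet_congr (q : K) {r s : ℕ} (h : r = s) (B : Matrix (Fin r) (Fin r) A)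
    (C : Matrix (Fin s) (Fin s) A)
    (hBC : ∀ i j, B i j = C (Fin.cast h i) (Fin.cast h j)) : rowDet q B = rowDet q C := by
  subst h
  exact congrArg _ (Matrix.ext hBC)

end Determinants

/-! ### Blocks of super Manin matrices -/

section SuperManin

open MulOpposite

variable {K A : Type*} [Field K] [Ring A] [Algebra K A]

lemma eps_of_lt {N : ℕ} {i j : Fin N} (h : i < j) : eps i j = -1 :=
  Int.sign_eq_neg_one_of_neg (by have : (i : ℕ) < j := h; omega)

lemma eps_of_gt {N : ℕ} {i j : Fin N} (h : j < i) : eps i j = 1 :=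
  Int.sign_eq_one_of_pos (by have : (j : ℕ) < i := h; omega)

/-- The even-even block of a `q`-super Manin matrix is `q`-Manin. -/
lemma IsQSuperManin.isQManin {q : K} (hq : q ≠ 0) {m N : ℕ} {M : Matrix (Fin N) (Fin N) A}
    (hM : IsQSuperManin q m M) {t : ℕ} (e : Fin t → Fin N) (he : StrictMono e)
    (hm : ∀ i, (e i : ℕ) < m) : IsQManin q (M.submatrix e e) := by
  have hp : ∀ i, parity m (e i) = 0 := fun i => if_pos (hm i)
  constructor
  · intro a i j hij
    have := hM.col (e i) (e j) (e a) (hp a)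
    rw [eps_of_lt (he hij), hp, hp] at this
    simpa [minor] using this
  · intro a b
    refine ⟨-q ^ eps (e b) (e a), fun i j hij => ?_⟩
    have := hM.cross (e i) (e a) (e j) (e b)
    rw [eps_of_lt (he hij), hp, hp, hp, hp] at this
    simp only [mul_zero, add_zero, pow_zero, mul_one, zpow_add₀ hq, zpow_neg_one] at this
    simp only [minor, Matrix.col_apply, Matrix.submatrix_apply, smul_sub, neg_smul, smul_smul]
    rw [← sub_eq_zero] at this ⊢
    rw [← this]
    module

/-- The odd-odd block of a `q⁻¹`-super Manin matrix is `q`-Manin after reflection in the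
antidiagonal. -/
lemma IsQSuperManin.isQManin_flip {q : K} (hq : q ≠ 0) {m N : ℕ} {Y : Matrix (Fin N) (Fin N) A}
    (hY : IsQSuperManin q⁻¹ m Y) {t : ℕ} (e : Fin t → Fin N) (he : StrictMono e)
    (hm : ∀ i, m ≤ (e i : ℕ)) : IsQManin q (flip (Y.submatrix e e)) := by
  have hp : ∀ i, parity m (e i) = 1 := fun i => if_neg (not_lt.2 (hm i))
  constructor
  · intro a i j hij
    have := hY.row (e a.rev) (e j.rev) (e i.rev) (hp _)
    rw [eps_of_gt (he (Fin.rev_lt_rev.2 hij)), hp, hp] at this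
    apply unop_injective
    simpa [minor, flip, show (-1 : K) ^ 4 = 1 by norm_num] using this
  · intro a b
    refine ⟨-q⁻¹ ^ eps (e b.rev) (e a.rev), fun i j hij => ?_⟩
    have := hY.cross (e b.rev) (e j.rev) (e a.rev) (e i.rev)
    rw [eps_of_gt (he (Fin.rev_lt_rev.2 hij)), hp, hp, hp, hp] at this
    apply unop_injective
    have h4 : (-1 : K) ^ 4 = 1 := by norm_num
    have h3 : (-1 : K) ^ 3 = -1 := by norm_num
    simp only [mul_one, Nat.reduceAdd, Nat.reduceMul, h3, h4, zpow_add₀ (inv_ne_zero hq),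
      zpow_one] at this
    simp only [minor, flip, Matrix.col_apply, Matrix.of_apply, Matrix.submatrix_apply, unop_sub,
      unop_mul, unop_op, unop_smul]
    rw [← sub_eq_zero] at this ⊢
    rw [← this]
    module

end SuperManin

/-! ### Inverses of block matrices and the Berezinian -/

section SchurComplement

variable {A : Type*} [Ring A]

lemma tailIdx_strictMono (m N : ℕ) : StrictMono (tailIdx m N) := fun i j h =>
  Nat.add_lt_add_left (show (i : ℕ) < j from h) m

lemma evenIdx_strictMono (m N : ℕ) : StrictMono (evenIdx m N) := fun _ _ h => h

lemma sum_eq_sum_castLE_add_sum_tailIdx {N k : ℕ} (hk : k ≤ N) (f : Fin N → A) :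
    ∑ x, f x = ∑ i, f (Fin.castLE hk i) + ∑ j, f (tailIdx k N j) := by
  have hN : k + (N - k) = N := by omega
  rw [← (finCongr hN).sum_comp, Fin.sum_univ_add]
  rfl

/-- Block multiplication. -/
lemma mul_submatrix_eq {N k : ℕ} (hk : k ≤ N) (M Y : Matrix (Fin N) (Fin N) A) {α β : Type*}
    (f : α → Fin N) (g : β → Fin N) :
    (M * Y).submatrix f g
      = M.submatrix f (Fin.castLE hk) * Y.submatrix (Fin.castLE hk) g
        + M.submatrix f (tailIdx k N) * Y.submatrix (tailIdx k N) g := by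
  ext i j
  simp only [Matrix.submatrix_apply, Matrix.mul_apply, Matrix.add_apply]
  exact sum_eq_sum_castLE_add_sum_tailIdx hk _

/-- Let `M` and `M₁₁` be invertible and `S` the Schur complement. Then `S` and `(M⁻¹)₂₂` are inverse
to each other, and `M₁₁⁻¹` is the Schur complement of `(M⁻¹)₂₂` in `M⁻¹`. -/
theorem schur_inverse {N k : ℕ} (hk : k ≤ N) {M : Matrix (Fin N) (Fin N) A} (hM : IsUnit M)
    (h11 : IsUnit (block11 hk M)) :
    schur hk M * block22 k (Ring.inverse M) = 1 ∧ block22 k (Ring.inverse M) * schur hk M = 1 ∧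
      Ring.inverse (block11 hk M) = block11 hk (Ring.inverse M)
        - block12 hk (Ring.inverse M) * schur hk M * block21 hk (Ring.inverse M) := by
  have hc : Function.Injective (Fin.castLE hk) := Fin.castLE_injective hk
  have ht : Function.Injective (tailIdx k N) := (tailIdx_strictMono k N).injective
  have hct : ∀ i j, Fin.castLE hk i ≠ tailIdx k N j := fun i j h => by
    have : (i : ℕ) = k + j := congrArg Fin.val h
    omega
  have one12 : (1 : Matrix (Fin N) (Fin N) A).submatrix (Fin.castLE hk) (tailIdx k N) = 0 := by
    ext i j
    exact Matrix.one_apply_ne (hct i j)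
  have one21 : (1 : Matrix (Fin N) (Fin N) A).submatrix (tailIdx k N) (Fin.castLE hk) = 0 := by
    ext i j
    exact Matrix.one_apply_ne (hct j i).symm
  have hMY := Ring.mul_inverse_cancel M hM
  have hYM := Ring.inverse_mul_cancel M hM
  have h1 := Ring.mul_inverse_cancel _ h11
  have h2 := Ring.inverse_mul_cancel _ h11
  set Y := Ring.inverse M
  have a11 := mul_submatrix_eq hk M Y (Fin.castLE hk) (Fin.castLE hk)
  have a12 := mul_submatrix_eq hk M Y (Fin.castLE hk) (tailIdx k N)
  have a22 := mul_submatrix_eq hk M Y (tailIdx k N) (tailIdx k N)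
  have b21 := mul_submatrix_eq hk Y M (tailIdx k N) (Fin.castLE hk)
  have b22 := mul_submatrix_eq hk Y M (tailIdx k N) (tailIdx k N)
  rw [hMY, Matrix.submatrix_one _ hc] at a11
  rw [hMY, one12] at a12
  rw [hMY, Matrix.submatrix_one _ ht] at a22
  rw [hYM, one21] at b21
  rw [hYM, Matrix.submatrix_one _ ht] at b22
  change 1 = block11 hk M * block11 hk Y + block12 hk M * block21 hk Y at a11
  change 0 = block11 hk M * block12 hk Y + block12 hk M * block22 k Y at a12
  change 1 = block21 hk M * block12 hk Y + block22 k M * block22 k Y at a22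
  change 0 = block21 hk Y * block11 hk M + block22 k Y * block21 hk M at b21
  change 1 = block21 hk Y * block12 hk M + block22 k Y * block22 k M at b22
  rw [schur]
  set M11 := block11 hk M
  set P := Ring.inverse M11
  have y12 : P * (block12 hk M * block22 k Y) = -block12 hk Y := by
    rw [eq_neg_of_add_eq_zero_right a12.symm, Matrix.mul_neg, ← Matrix.mul_assoc, h2,
      Matrix.one_mul]
  have y21 : block22 k Y * block21 hk M * P = -block21 hk Y := by
    rw [eq_neg_of_add_eq_zero_right b21.symm, Matrix.neg_mul, Matrix.mul_assoc, h1,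
      Matrix.mul_one]
  have s1 : (block22 k M - block21 hk M * P * block12 hk M) * block22 k Y = 1 := by
    rw [Matrix.sub_mul, Matrix.mul_assoc, Matrix.mul_assoc, y12, a22, Matrix.mul_neg]
    abel
  have s2 : block22 k Y * (block22 k M - block21 hk M * P * block12 hk M) = 1 := by
    rw [Matrix.mul_sub, ← Matrix.mul_assoc, ← Matrix.mul_assoc, y21, b22, Matrix.neg_mul]
    abel
  refine ⟨s1, s2, ?_⟩
  have y12' : block12 hk Y * (block22 k M - block21 hk M * P * block12 hk M)
      = -(P * block12 hk M) := by
    rw [← neg_eq_iff_eq_neg, ← Matrix.neg_mul, ← y12, ← Matrix.mul_assoc, Matrix.mul_assoc, s2,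
      Matrix.mul_one]
  have y11 : P = block11 hk Y + P * (block12 hk M * block21 hk Y) := by
    calc P = P * (M11 * block11 hk Y + block12 hk M * block21 hk Y) := by
          rw [← a11, Matrix.mul_one]
      _ = _ := by rw [Matrix.mul_add, ← Matrix.mul_assoc, h2, Matrix.one_mul]
  rw [y12', Matrix.neg_mul, sub_neg_eq_add, Matrix.mul_assoc, ← y11]

end SchurComplement

end QSuper

open QSuper in
/-- Schur complement theorem for the quantum Berezinian. The first `m` of the `m + n` indices are
even and the last `n` are odd. The block `M₁₁` inherits its parities (its indices below `m` are
even), and so does the Schur complement (its indices below `m - k` are even; none if `m ≤ k`). -/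
theorem theorem4p6 {K A : Type*} [Field K] [Ring A] [Algebra K A] (q : K) (hq : q ≠ 0)
    (m n k : ℕ) (hk : k ≤ m + n) (M : Matrix (Fin (m + n)) (Fin (m + n)) A)
    (hM : QSuper.IsQSuperManin q m M)
    (hunit : IsUnit M)
    (hinv : QSuper.IsQSuperManin q⁻¹ m (Ring.inverse M))
    (h11 : IsUnit (QSuper.block11 hk M)) :
    IsUnit (QSuper.schur hk M) ∧
      QSuper.ber q m M =
        QSuper.ber q m (QSuper.block11 hk M) * QSuper.ber q (m - k) (QSuper.schur hk M) := by
  obtain ⟨s1, s2, hP⟩ := schur_inverse hk hunit h11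
  have hS : IsUnit (schur hk M) := ⟨⟨_, _, s1, s2⟩, rfl⟩
  have hSinv : Ring.inverse (schur hk M) = block22 k (Ring.inverse M) :=
    left_inv_eq_right_inv (Ring.inverse_mul_cancel _ hS) s1
  have h1 := Ring.mul_inverse_cancel _ h11
  refine ⟨hS, ?_⟩
  rw [ber, ber, ber, hSinv]
  rcases le_total k m with hkm | hmk
  -- `M₁₁` is purely even: both sides have the odd-odd block of `M⁻¹` as their row determinant, and
  -- the column determinant of the even-even block of `M` factors.
  · have hcol := colDet_eq_mul (q := q) (k := k) (l := m - k) (t := min m (m + n)) (by omega)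
      (hM.isQManin hq (evenIdx m (m + n)) (evenIdx_strictMono _ _) (fun i => by
        have := i.isLt
        rw [evenIdx, Fin.val_castLE]
        omega))
      (fun i => ⟨i, by omega⟩) (fun j => ⟨k + j, by omega⟩) (fun _ => rfl) (fun _ => rfl)
      ((Ring.inverse (block11 hk M) * block12 hk M).submatrix id
        fun j : Fin (m - k) => ⟨j, by omega⟩)
      (by
        have h := congrArg (fun Z => (Z * block12 hk M).submatrix id
          fun j : Fin (m - k) => (⟨j, by omega⟩ : Fin (m + n - k))) h1
        simp only [Matrix.one_mul, Matrix.mul_assoc] at h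
        exact h)
    rw [hcol, rowDet_of_eq_zero q (by omega) ((Ring.inverse (block11 hk M)).submatrix _ _),
      mul_one, mul_assoc]
    congr 1
    · exact colDet_congr q (by omega) _ _ fun _ _ => rfl
    congr 1
    · rw [schur, Matrix.mul_assoc]
      exact colDet_congr q (by omega) _ _ fun _ _ => rfl
    · have e : ∀ i : Fin (m + n - m), tailIdx m (m + n) i = tailIdx k (m + n)
          (tailIdx (m - k) (m + n - k) (Fin.cast (by omega) i)) := fun i =>
        Fin.ext (by simp only [tailIdx, Fin.val_cast]; omega)
      refine rowDet_congr q (by omega) _ _ fun i j => ?_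
      rw [block22, Matrix.submatrix_apply, Matrix.submatrix_apply, Matrix.submatrix_apply, e i, e j]
  -- The Schur complement is purely odd: both sides have the same even-even block of `M` in their
  -- column determinant, and the row determinant of the odd-odd block of `M⁻¹` factors, with
  -- elimination matrix `Y₁₂ S = Y₁₂ Y₂₂⁻¹` restricted to the odd rows.
  · set Y := Ring.inverse M
    have hrow := rowDet_eq_mul (q := q) (k := k - m) (l := m + n - k) (t := m + n - m) (by omega)
      (hinv.isQManin_flip hq (tailIdx m (m + n)) (tailIdx_strictMono _ _)
        (fun i => Nat.le_add_right _ _))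
      (fun i => ⟨i, by omega⟩) (fun j => ⟨k - m + j, by omega⟩) (fun _ => rfl) (fun _ => rfl)
      ((block12 hk Y * schur hk M).submatrix (tailIdx m k) id)
      (by
        have h := congrArg (fun Z => (block12 hk Y * Z).submatrix (tailIdx m k) id) s1
        have e2 : ∀ j : Fin (m + n - k), tailIdx m (m + n) ⟨k - m + j, by omega⟩
            = tailIdx k (m + n) j := fun j => Fin.ext (by simp only [tailIdx]; omega)
        simp only [Matrix.mul_one, ← Matrix.mul_assoc] at h
        simp only [Matrix.submatrix_submatrix, Function.comp_def, e2]
        exact h)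
    have e2 : ∀ j : Fin (m + n - k), tailIdx m (m + n) ⟨k - m + j, by omega⟩
        = tailIdx k (m + n) j := fun j => Fin.ext (by simp only [tailIdx]; omega)
    rw [hrow, colDet_of_eq_zero q (by omega) ((schur hk M).submatrix _ _), one_mul, ← mul_assoc]
    congr 1
    · congr 1
      · exact colDet_congr q (by omega) _ _ fun _ _ => rfl
      · rw [hP]
        simp only [Matrix.submatrix_submatrix, Function.comp_def, e2]
        rfl
    · have e : ∀ j : Fin (m + n - k), tailIdx k (m + n) j = tailIdx k (m + n)
          (tailIdx (m - k) (m + n - k) (Fin.cast (by omega) j)) := fun j =>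
        Fin.ext (by simp only [tailIdx, Fin.val_cast]; omega)
      simp only [Matrix.submatrix_submatrix, Function.comp_def, e2]
      exact rowDet_congr q (by omega) _ _ fun i j => congrArg₂ Y (e i) (e j)
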